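/- **Setting (Resource Size GAP with predictions, private graph model).** Let $L$ be a finite set of agents and $R$ a finite set of resources. The public data are values $v_{ij}>0$ ($i\in L$, $j\in R$), sizes $s_j>0$ and capacities $C_j\ge s_j$ ($j\in R$), and a predicted assignment $\hat M\subseteq L\times R$. Here an *assignment* is a set of edges in which every agent has at most one edge, and $\hat M$ may contain edges that are not declared. For $M\subseteq L\times R$ put $v(M)=\sum_{(i,j)\in M}v_{ij}$ and $M(j)=\{i:(i,j)\in M\}$. $M$ *respects the capacities* if $|M(j)|\,s_j\le C_j$ for all $j$. $M$ is *feasible* for a set $D\subseteq L\times R$ of declared edges if it is an assignment, $M\subseteq D$, and $M$ respects the capacities. $M^*_D$ is a feasible assignment for $D$ of maximum value, and the prediction error is $\eta(D)=1-v(\hat M\cap D)/v(M^*_D)$ (for $D\neq\emptyset$). Each agent $i$ has a private set $E_i\subseteq\{i\}\times R$ of true edges and declares a set $D_i\subseteq\{i\}\times R$; $E=\bigcup_i E_i$ and $D=\bigcup_iD_i$. A deterministic mechanism maps every $D$ to a feasible assignment $M$ for $D$. The utility $u_i(D)$ is $v_{ij}$ if $(i,j)\in M\cap E_i$ for some $j$,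 and $0$ otherwise. The mechanism is *group-strategyproof* if for all $E$, all $D$, every nonempty $S\subseteq L$ and all misreports $D'_S$ there is $i\in S$ with $u_i(E_S,D_{-S})\ge u_i(D'_S,D_{-S})$. **Boost for bipartite matching.** Given agents $L$, resources $K$, values $v_{ij}>0$, a predicted matching $\hat N\subseteq L\times K$, declared edges $D$ and $\gamma\ge1$, the offer is $\theta_{ij}=\gamma v_{ij}$ if $(i,j)\in\hat N$ and $\theta_{ij}=v_{ij}$ otherwise. Each agent $i$ strictly orders $K$ by $v_{ij}$, and each resource $j$ strictly orders $L$ by $\theta_{ij}$; ties are broken by fixed strict rules that do not depend on the declarations. Start with $N=\emptyset$ and $P=D$. While some agent is active (it is unmatched in $N$ and has an edge in $P$), choose any active agent $i$ and the best resource $j$ for $i$ among the edges $(i,j)\in P$. If $j$ is unmatched in $N$ or prefers $i$ to its mate, delete the edge of $N$ at $j$ (if any) and add $(i,j)$ to $N$. In either case delete $(i,j)$ from $P$. Return $N$. **Boost for Resource Size GAP.** Replace each $j\in R$ by $m_j=\lfloor C_j/s_j\rfloor$ copies $j_1,\dots,j_{m_j}$, which inherit the declared edges and the values of $j$. For each $j$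 fix an enumeration $i_1,\dots,i_{k_j}$ of $\hat M(j)$, not depending on the declarations, and take as predicted matching the edges $(i_\ell,j_\ell)$ with $\ell\le\min(k_j,m_j)$. Run Boost on this instance of bipartite matching, and assign each matched agent to the resource of which it received a copy. **Corollary 4.4.** Let $\hat\eta\in[0,1]$. For every instance as above, all tie-breaking rules, all enumerations and every way of choosing the active agents, the following holds. 1. For every $\gamma\ge1$, Boost returns a feasible assignment for every $D$ and is group-strategyproof. If moreover $\hat M$ respects the capacities, then for every $D$ with prediction error at most $\hat\eta$ the returned assignment $M$ satisfies $g(\hat\eta,\gamma)\,v(M)\ge v(M^*_D)$, where $$g(\hat\eta,\gamma)=\begin{cases}\dfrac{1+\gamma}{\gamma(1-\hat\eta)}&\text{if }\hat\eta\le1-\frac1\gamma,\\[1ex]1+\gamma&\text{otherwise.}\end{cases}$$ 2. For $\gamma=1$, Boost is a deterministic group-strategyproof mechanism with $2\,v(M)\ge v(M^*_D)$ for every $D$ and every predicted assignment (in particular $\hat M=\emptyset$, that is, without predictions). -/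

import Mathlib

namespace GAPPred

/-! ### Assignments and matchings -/

/-- A set of edges is a (many-to-one) assignment if each agent is incident to at most one edge. -/
def IsAssignment {L R : Type*} (M : Finset (L × R)) : Prop :=
  ∀ (i : L) (j k : R), (i, j) ∈ M → (i, k) ∈ M → j = k

/-- A one-to-one assignment. -/
def IsMatching {L R : Type*} (M : Finset (L × R)) : Prop :=
  IsAssignment M ∧ ∀ (i k : L) (j : R), (i, j) ∈ M → (k, j) ∈ M → i = k

/-! ### Boost on bipartite matching with predictions -/

/-- The public data, apart from the declared edges, of an instance of the bipartite matching problem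
with predictions: the values and the predicted matching, any matching of the complete graph. -/
structure BMPInstance (L K : Type*) where
  value : L → K → ℝ
  pred : Finset (L × K)
  value_pos : ∀ i j, 0 < value i j
  pred_matching : IsMatching pred

/-- Fixed tie-breaking rules: a strict order on the resources for every agent, and a strict order
on the agents for every resource (a larger number wins). -/
structure TieBreaking (L K : Type*) where
  agent : L → K → ℕ
  agent_injective : ∀ i, Function.Injective (agent i)
  resource : K → L → ℕ
  resource_injective : ∀ j, Function.Injective (resource j)

/-- A state of the mechanism: the tentative matching `M` and the set `P` of the edges through which
no proposal has been made yet (`P_i` consists of the edges of `P` at agent `i`). -/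
structure BoostState (L K : Type*) where
  M : Finset (L × K)
  P : Finset (L × K)

/-- The active agents: those with a proposal left that are not tentatively matched. -/
def BoostState.active {L K : Type*} [DecidableEq L] (s : BoostState L K) : Finset L :=
  s.P.image Prod.fst \ s.M.image Prod.fst

/-- A rule that picks the next agent to propose, among the active ones. -/
abbrev SelectionRule (L K : Type*) [DecidableEq L] : Type _ :=
  (s : BoostState L K) → s.active.Nonempty → {i : L // i ∈ s.active}

namespace BMPInstance

variable {L K : Type*} [DecidableEq L]

/-- The offer `θ_{ij}`: the value, boosted by the factor `γ` on predicted edges. -/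
noncomputable def offer [DecidableEq K] (B : BMPInstance L K) (γ : ℝ) (i : L) (j : K) : ℝ :=
  if (i, j) ∈ B.pred then γ * B.value i j else B.value i j

/-- Agent `i` compares resources lexicographically by value and tie-breaking rule. -/
noncomputable def agentRank (B : BMPInstance L K) (τ : TieBreaking L K) (i : L) (j : K) : ℝ ×ₗ ℕ :=
  toLex (B.value i j, τ.agent i j)

/-- Resource `j` compares agents lexicographically by offer and tie-breaking rule. -/
noncomputable def resourceRank [DecidableEq K] (B : BMPInstance L K) (γ : ℝ)
    (τ : TieBreaking L K) (j : K) (i : L) : ℝ ×ₗ ℕ :=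
  toLex (B.offer γ i j, τ.resource j i)

theorem exists_best (B : BMPInstance L K) (τ : TieBreaking L K) (s : BoostState L K) (i : L)
    (hi : i ∈ s.active) :
    ∃ j, (i, j) ∈ s.P ∧ ∀ k, (i, k) ∈ s.P → B.agentRank τ i k ≤ B.agentRank τ i j := by
  obtain ⟨⟨i', j₀⟩, he, rfl⟩ := Finset.mem_image.1 (Finset.mem_sdiff.1 hi).1
  obtain ⟨e, he', hmax⟩ := Finset.exists_max_image (s.P.filter fun e => e.1 = i')
    (fun e => B.agentRank τ i' e.2) ⟨(i', j₀), Finset.mem_filter.2 ⟨he, rfl⟩⟩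
  obtain ⟨heP, hei⟩ := Finset.mem_filter.1 he'
  refine ⟨e.2, ?_, fun k hk => hmax (i', k) (Finset.mem_filter.2 ⟨hk, rfl⟩)⟩
  have h : (i', e.2) = e := Prod.ext hei.symm rfl
  exact h ▸ heP

/-- The resource that the active agent `i` proposes to: the best one left in `P_i`. -/
noncomputable def nextProposal (B : BMPInstance L K) (τ : TieBreaking L K) (s : BoostState L K)
    (i : L) (hi : i ∈ s.active) : K :=
  Classical.choose (B.exists_best τ s i hi)

variable [DecidableEq K]

open Classical in
/-- One iteration. Agent `i` makes an offer to its next resource `j`. If `j` prefers the offer to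
that of its current mate (or has none), `j` drops its mate and `(i, j)` enters the matching.
In any case `(i, j)` is removed from the proposals. -/
noncomputable def step (B : BMPInstance L K) (γ : ℝ) (τ : TieBreaking L K) (s : BoostState L K)
    (i : L) (hi : i ∈ s.active) : BoostState L K where
  M := if ∀ k, (k, B.nextProposal τ s i hi) ∈ s.M →
          B.resourceRank γ τ (B.nextProposal τ s i hi) k
            < B.resourceRank γ τ (B.nextProposal τ s i hi) i
        then insert (i, B.nextProposal τ s i hi)
          (s.M.filter fun e => e.2 ≠ B.nextProposal τ s i hi)
        else s.M
  P := s.P.erase (i, B.nextProposal τ s i hi)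

/-- The main loop: iterate while there is an active agent. -/
noncomputable def boostLoop (B : BMPInstance L K) (γ : ℝ) (τ : TieBreaking L K)
    (sel : SelectionRule L K) (s : BoostState L K) : BoostState L K :=
  if h : s.active.Nonempty then
    boostLoop B γ τ sel (B.step γ τ s (sel s h).1 (sel s h).2)
  else s
termination_by s.P.card
decreasing_by
  exact Finset.card_erase_lt_of_mem (Classical.choose_spec (B.exists_best τ s _ (sel s h).2)).1

/-- `Boost`, on the declared edges `D`. -/
noncomputable def boost (B : BMPInstance L K) (γ : ℝ) (τ : TieBreaking L K)
    (sel : SelectionRule L K) (D : Finset (L × K)) : Finset (L × K) :=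
  (B.boostLoop γ τ sel ⟨∅, D⟩).M

end BMPInstance

/-! ### Resource Size GAP with predictions -/

/-- The public data, apart from the declared edges, of an instance of Resource Size GAP with
predictions; `size j` is the size at resource `j`, common to all agents. The prediction is any
assignment of the complete graph. -/
structure RSGAPInstance (L R : Type*) where
  value : L → R → ℝ
  size : R → ℝ
  capacity : R → ℝ
  pred : Finset (L × R)
  value_pos : ∀ i j, 0 < value i j
  size_pos : ∀ j, 0 < size j
  size_le_capacity : ∀ j, size j ≤ capacity j
  pred_assignment : IsAssignment pred

namespace RSGAPInstance

variable {L R : Type*} [DecidableEq R]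

/-- The total size assigned to each resource is at most its capacity. -/
def RespectsCapacities (I : RSGAPInstance L R) (M : Finset (L × R)) : Prop :=
  ∀ j, ∑ e ∈ M with e.2 = j, I.size e.2 ≤ I.capacity j

/-- Feasible assignments of the graph with edge set `D`. -/
def Feasible (I : RSGAPInstance L R) (D M : Finset (L × R)) : Prop :=
  M ⊆ D ∧ IsAssignment M ∧ I.RespectsCapacities M

/-- The value of a set of edges. -/
def val (I : RSGAPInstance L R) (M : Finset (L × R)) : ℝ :=
  ∑ e ∈ M, I.value e.1 e.2

theorem feasible_empty (I : RSGAPInstance L R) (D : Finset (L × R)) : I.Feasible D ∅ :=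
  ⟨Finset.empty_subset D, fun _ _ _ h => absurd h (Finset.notMem_empty _),
    fun j => by simpa using (I.size_pos j).le.trans (I.size_le_capacity j)⟩

open Classical in
/-- The value `v(M*_D)` of an optimal assignment: the maximum value of a feasible assignment. -/
noncomputable def optValue (I : RSGAPInstance L R) (D : Finset (L × R)) : ℝ :=
  (D.powerset.filter fun M => I.Feasible D M).sup'
    ⟨∅, Finset.mem_filter.2 ⟨Finset.empty_mem_powerset D, I.feasible_empty D⟩⟩ I.val

variable [DecidableEq L]

/-- The prediction error `η = 1 - v(M̂ ∩ D) / v(M*_D)`. It is meant for nonempty `D`, where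
`v(M*_D) > 0`. -/
noncomputable def predictionError (I : RSGAPInstance L R) (D : Finset (L × R)) : ℝ :=
  1 - I.val (I.pred ∩ D) / I.optValue D

/-! The private graph model -/

/-- The utility of agent `i` with true edges `E` when the assignment is `M`: the value of the edge
of `M ∩ E` at `i`, and zero if there is none (an assignment has at most one such edge). -/
def utility (I : RSGAPInstance L R) (E M : Finset (L × R)) (i : L) : ℝ :=
  ∑ e ∈ M ∩ E with e.1 = i, I.value e.1 e.2

/-- The declarations in which the agents of `S` declare as in `X` and the others as in `Y`. -/
def combine (S : Finset L) (X Y : Finset (L × R)) : Finset (L × R) :=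
  (X.filter fun e => e.1 ∈ S) ∪ (Y.filter fun e => e.1 ∉ S)

/-- Group-strategyproofness, on the public data `I`, of a deterministic mechanism that maps
declared edges to an assignment: for all true edges `E`, all declarations `D`, all nonempty groups
`S` and all misreports `D'` of `S`, some member of `S` does not gain. -/
def GroupStrategyproof (I : RSGAPInstance L R)
    (mech : Finset (L × R) → Finset (L × R)) : Prop :=
  ∀ (E D D' : Finset (L × R)) (S : Finset L), S.Nonempty →
    ∃ i ∈ S, I.utility E (mech (combine S D' D)) i ≤ I.utility E (mech (combine S E D)) i

/-! The reduction to bipartite matching -/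

/-- The number `m_j = ⌊C_j / s_j⌋` of copies of resource `j`. -/
noncomputable def numCopies (I : RSGAPInstance L R) (j : R) : ℕ :=
  ⌊I.capacity j / I.size j⌋₊

/-- The copies of the resources. -/
abbrev Copy (I : RSGAPInstance L R) : Type _ :=
  (j : R) × Fin (I.numCopies j)

/-- For each resource `j`, an enumeration (starting at `0`) of the agents predicted for `j`. -/
structure PredNumbering (I : RSGAPInstance L R) where
  idx : L → R → ℕ
  bijOn : ∀ j, Set.BijOn (fun i => idx i j) {i | (i, j) ∈ I.pred}
    (Set.Iio (I.pred.filter fun e => e.2 = j).card)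

variable [Fintype L] [Fintype R]

/-- Every copy of a resource inherits its edges. -/
noncomputable def copyEdges (I : RSGAPInstance L R) (D : Finset (L × R)) : Finset (L × I.Copy) :=
  Finset.univ.filter fun e => (e.1, e.2.1) ∈ D

/-- The instance with copied resources: values are inherited, and the `l`-th agent predicted for `j`
is predicted for the `l`-th copy of `j` (if that copy exists). -/
noncomputable def toBMP (I : RSGAPInstance L R) (ν : I.PredNumbering) : BMPInstance L I.Copy where
  value i c := I.value i c.1
  pred := Finset.univ.filter fun e => (e.1, e.2.1) ∈ I.pred ∧ ν.idx e.1 e.2.1 = (e.2.2 : ℕ)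
  value_pos i c := I.value_pos i c.1
  pred_matching := by
    constructor
    · rintro i ⟨j, a⟩ ⟨k, b⟩ h₁ h₂
      simp only [Finset.mem_filter, Finset.mem_univ, true_and] at h₁ h₂
      obtain rfl := I.pred_assignment i j k h₁.1 h₂.1
      have : a = b := Fin.ext (h₁.2.symm.trans h₂.2)
      rw [this]
    · rintro i k ⟨j, a⟩ h₁ h₂
      simp only [Finset.mem_filter, Finset.mem_univ, true_and] at h₁ h₂
      exact (ν.bijOn j).injOn h₁.1 h₂.1 (h₁.2.trans h₂.2.symm)

/-- `Boost` for Resource Size GAP: run it on the copied instance and assign each agent to the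
resource whose copy it is matched to. The rule that picks the proposing agent may depend on the
declarations. -/
noncomputable def boost (I : RSGAPInstance L R) (γ : ℝ) (ν : I.PredNumbering)
    (τ : TieBreaking L I.Copy) (sel : Finset (L × R) → SelectionRule L I.Copy)
    (D : Finset (L × R)) : Finset (L × R) :=
  ((I.toBMP ν).boost γ τ (sel D) (I.copyEdges D)).image fun e => (e.1, e.2.1)

end RSGAPInstance

/-- The approximation guarantee `g(η̂, γ)`. -/
noncomputable def guarantee (ηhat γ : ℝ) : ℝ :=
  if ηhat ≤ 1 - 1 / γ then (1 + γ) / (γ * (1 - ηhat)) else 1 + γ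

end GAPPred

namespace GAPPred

/-! Boost is deferred acceptance with the agents proposing and the resources ranking by offers, so
its outcome `M` is stable for the declared edges (`boost_stable`): for each declared `(i, j)`,
either `i` has a mate it likes at least as much, or `j` holds an agent whose offer is at least as
high.

Approximation is a charging argument (`sum_charge_le`). Since `v ≤ θ ≤ γ v`, an edge of any matching
is paid for by the edge of `M` at its agent with weight `1` or at its resource with weight `γ`,
which gives `1 + γ`. A predicted edge offers `γ v`. If an unpredicted rival wins its resource, the
rival's value is at least `γ v`, so `γ v(N̂ ∩ D) ≤ (1 + γ) v(M)`. An error of at most `η̂` turns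
this into the other branch of `guarantee`.

Group-strategyproofness is the blocking lemma for stable matchings. Let `N` be the outcome of a
misreport from which all of `S` gain, and `A ⊇ S` the set of agents who prefer `N` to `M`. In the
private graph model a gain comes from a true edge, so `N` is available under truthful reports. Then
some agent outside `A` blocks `N` (`exists_blocking_of_mates_subset`, `no_joint_gain`). That agent
is not in `S`, so its declaration is unchanged, and `N` would not be stable for the misreport.

Splitting resources into copies carries everything over to Resource Size GAP, because all agents
have the same size at a resource. -/

theorem le_sum_filter {α : Type*} {M : Finset α} {p : α → Prop} [DecidablePred p] (w : α → ℝ)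
    (hw : ∀ e, 0 ≤ w e) {e : α} (he : e ∈ M) (hp : p e) : w e ≤ ∑ f ∈ M with p f, w f :=
  Finset.single_le_sum (fun f _ => hw f) (Finset.mem_filter.2 ⟨he, hp⟩)

/-! ### The loop of Boost on bipartite matching -/

namespace BMPInstance

variable {L K : Type*}

theorem agentRank_injective (B : BMPInstance L K) (τ : TieBreaking L K) (i : L) :
    Function.Injective (B.agentRank τ i) := by
  intro j k h
  have h' := congrArg (fun x => (ofLex x).2) h
  exact τ.agent_injective i h'

theorem value_le_of_agentRank_le (B : BMPInstance L K) (τ : TieBreaking L K) {i : L} {j k : K}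
    (h : B.agentRank τ i j ≤ B.agentRank τ i k) : B.value i j ≤ B.value i k := by
  rcases (Prod.Lex.toLex_le_toLex).1 h with h | h
  · exact h.le
  · exact h.1.le

theorem agentRank_lt_of_value_lt (B : BMPInstance L K) (τ : TieBreaking L K) {i : L} {j k : K}
    (h : B.value i j < B.value i k) : B.agentRank τ i j < B.agentRank τ i k :=
  (Prod.Lex.toLex_lt_toLex).2 (Or.inl h)

variable [DecidableEq L]

theorem notMem_of_active {s : BoostState L K} {i : L} (hi : i ∈ s.active) (j : K) :
    (i, j) ∉ s.M := fun h =>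
  (Finset.mem_sdiff.1 hi).2 (Finset.mem_image.2 ⟨(i, j), h, rfl⟩)

theorem nextProposal_mem (B : BMPInstance L K) (τ : TieBreaking L K) (s : BoostState L K)
    (i : L) (hi : i ∈ s.active) : (i, B.nextProposal τ s i hi) ∈ s.P :=
  (Classical.choose_spec (B.exists_best τ s i hi)).1

theorem agentRank_le_nextProposal (B : BMPInstance L K) (τ : TieBreaking L K)
    (s : BoostState L K) (i : L) (hi : i ∈ s.active) (k : K) (hk : (i, k) ∈ s.P) :
    B.agentRank τ i k ≤ B.agentRank τ i (B.nextProposal τ s i hi) :=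
  (Classical.choose_spec (B.exists_best τ s i hi)).2 k hk

variable [DecidableEq K]

theorem resourceRank_injective (B : BMPInstance L K) (γ : ℝ) (τ : TieBreaking L K) (j : K) :
    Function.Injective (B.resourceRank γ τ j) := by
  intro i k h
  have h' := congrArg (fun x => (ofLex x).2) h
  exact τ.resource_injective j h'

theorem offer_le_of_resourceRank_le (B : BMPInstance L K) (γ : ℝ) (τ : TieBreaking L K)
    {j : K} {i k : L} (h : B.resourceRank γ τ j i ≤ B.resourceRank γ τ j k) :
    B.offer γ i j ≤ B.offer γ k j := by
  rcases (Prod.Lex.toLex_le_toLex).1 h with h | h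
  · exact h.le
  · exact h.1.le

/-- The invariants of the main loop on the declared edges `D`: agents propose in decreasing order
of preference, and a resource that has received a proposal holds one that is at least as good. -/
structure LoopInvariant (B : BMPInstance L K) (γ : ℝ) (τ : TieBreaking L K) (D : Finset (L × K))
    (s : BoostState L K) : Prop where
  M_subset : s.M ⊆ D
  P_subset : s.P ⊆ D
  matching : IsMatching s.M
  agentRank_lt : ∀ i j k, (i, j) ∈ s.M → (i, k) ∈ s.P → B.agentRank τ i k < B.agentRank τ i j
  exists_mate : ∀ i j, (i, j) ∈ D → (i, j) ∉ s.P →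
    ∃ k, (k, j) ∈ s.M ∧ B.resourceRank γ τ j i ≤ B.resourceRank γ τ j k

theorem LoopInvariant.initial (B : BMPInstance L K) (γ : ℝ) (τ : TieBreaking L K)
    (D : Finset (L × K)) : B.LoopInvariant γ τ D ⟨∅, D⟩ where
  M_subset := Finset.empty_subset D
  P_subset := Finset.Subset.refl D
  matching := ⟨fun _ _ _ h => absurd h (Finset.notMem_empty _),
    fun _ _ _ h => absurd h (Finset.notMem_empty _)⟩
  agentRank_lt := fun _ _ _ h => absurd h (Finset.notMem_empty _)
  exists_mate := fun _ _ h h' => absurd h h'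

/-- A resource changes its mate only for a better one, so what it holds dominates every past
proposal; an agent's held edge beats its remaining ones because it proposes best first. -/
theorem LoopInvariant.step {B : BMPInstance L K} {γ : ℝ} {τ : TieBreaking L K}
    {D : Finset (L × K)} {s : BoostState L K} (h : B.LoopInvariant γ τ D s) (i : L)
    (hi : i ∈ s.active) : B.LoopInvariant γ τ D (B.step γ τ s i hi) := by
  have hP := B.nextProposal_mem τ s i hi
  have hbest := B.agentRank_le_nextProposal τ s i hi
  have hun := fun j => notMem_of_active hi j
  unfold BMPInstance.step
  generalize B.nextProposal τ s i hi = j at hP hbest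
  have hPe : s.P.erase (i, j) ⊆ D := (Finset.erase_subset _ _).trans h.P_subset
  by_cases hacc : ∀ k, (k, j) ∈ s.M → B.resourceRank γ τ j k < B.resourceRank γ τ j i
  · rw [if_pos hacc]
    refine ⟨?_, hPe, ⟨?_, ?_⟩, ?_, ?_⟩
    · exact Finset.insert_subset (h.P_subset hP) ((Finset.filter_subset _ _).trans h.M_subset)
    · intro a b c hb hc
      simp only [Finset.mem_insert, Prod.mk.injEq, Finset.mem_filter] at hb hc
      rcases hb with ⟨rfl, rfl⟩ | ⟨hb, -⟩ <;> rcases hc with ⟨h1, h2⟩ | ⟨hc, -⟩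
      · exact h2.symm
      · exact absurd hc (hun c)
      · exact absurd (h1 ▸ hb) (hun b)
      · exact h.matching.1 a b c hb hc
    · intro a b c hb hc
      simp only [Finset.mem_insert, Prod.mk.injEq, Finset.mem_filter] at hb hc
      rcases hb with ⟨rfl, rfl⟩ | ⟨hb, hb'⟩ <;> rcases hc with ⟨h1, h2⟩ | ⟨hc, hc'⟩
      · exact h1.symm
      · exact absurd rfl hc'
      · exact absurd h2 hb'
      · exact h.matching.2 a b c hb hc
    · intro a b c hb hc
      simp only [Finset.mem_insert, Prod.mk.injEq, Finset.mem_filter] at hb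
      obtain ⟨hne, hcP⟩ := Finset.mem_erase.1 hc
      rcases hb with ⟨rfl, rfl⟩ | ⟨hb, -⟩
      · refine lt_of_le_of_ne (hbest c hcP) fun he => hne ?_
        rw [B.agentRank_injective τ a he]
      · exact h.agentRank_lt a b c hb hcP
    · intro a b hD hnP
      by_cases hb : b = j
      · subst hb
        refine ⟨i, Finset.mem_insert_self _ _, ?_⟩
        by_cases ha : a = i
        · rw [ha]
        · obtain ⟨k, hk, hle⟩ := h.exists_mate a b hD fun hp =>
            hnP (Finset.mem_erase.2 ⟨fun he => ha (congrArg Prod.fst he), hp⟩)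
          exact hle.trans (hacc k hk).le
      · obtain ⟨k, hk, hle⟩ := h.exists_mate a b hD fun hp =>
          hnP (Finset.mem_erase.2 ⟨fun he => hb (congrArg Prod.snd he), hp⟩)
        exact ⟨k, Finset.mem_insert_of_mem (Finset.mem_filter.2 ⟨hk, hb⟩), hle⟩
  · rw [if_neg hacc]
    refine ⟨h.M_subset, hPe, h.matching, ?_, ?_⟩
    · exact fun a b c hb hc => h.agentRank_lt a b c hb (Finset.mem_of_mem_erase hc)
    · intro a b hD hnP
      by_cases he : (a, b) = (i, j)
      · obtain ⟨rfl, rfl⟩ := Prod.mk.inj he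
        push Not at hacc
        exact hacc
      · exact h.exists_mate a b hD fun hp => hnP (Finset.mem_erase.2 ⟨he, hp⟩)

theorem step_M_subset (B : BMPInstance L K) (γ : ℝ) (τ : TieBreaking L K) (s : BoostState L K)
    (i : L) (hi : i ∈ s.active) :
    (B.step γ τ s i hi).M ⊆ insert (i, B.nextProposal τ s i hi) s.M := by
  unfold step
  dsimp only
  split_ifs
  · exact Finset.insert_subset_insert _ (Finset.filter_subset _ _)
  · exact Finset.subset_insert _ _

/-- Induction along the main loop. -/
theorem boostLoop_induction (B : BMPInstance L K) (γ : ℝ) (τ : TieBreaking L K)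
    (sel : SelectionRule L K) (p : BoostState L K → Prop)
    (hstep : ∀ s i hi, p s → p (B.step γ τ s i hi)) (s : BoostState L K) (hs : p s) :
    p (B.boostLoop γ τ sel s) ∧ ¬ (B.boostLoop γ τ sel s).active.Nonempty := by
  fun_induction boostLoop B γ τ sel s with
  | case1 s h ih => exact ih (hstep _ _ _ hs)
  | case2 s h => exact ⟨hs, h⟩

/-- A property that holds at the end of the loop but not at its start becomes true in some step. -/
theorem exists_step_of_boostLoop (B : BMPInstance L K) (γ : ℝ) (τ : TieBreaking L K)
    (sel : SelectionRule L K) (p T : BoostState L K → Prop)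
    (hstep : ∀ s i hi, p s → p (B.step γ τ s i hi)) (s : BoostState L K) (hs : p s)
    (hT : ¬ T s) (hT' : T (B.boostLoop γ τ sel s)) :
    ∃ t i hi, p t ∧ ¬ T t ∧ T (B.step γ τ t i hi) ∧
      B.boostLoop γ τ sel s = B.boostLoop γ τ sel (B.step γ τ t i hi) := by
  fun_induction boostLoop B γ τ sel s with
  | case1 s h ih =>
    by_cases hc : T (B.step γ τ s (sel s h).1 (sel s h).2)
    · exact ⟨s, _, _, hs, hT, hc, rfl⟩
    · exact ih (hstep _ _ _ hs) hc hT'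
  | case2 s h => exact absurd hT' hT

/-- An edge that has been proposed and is not held is lost for good. This locates the final edges at
intermediate states. -/
theorem boostLoop_M_subset (B : BMPInstance L K) (γ : ℝ) (τ : TieBreaking L K)
    (sel : SelectionRule L K) (s : BoostState L K) :
    (B.boostLoop γ τ sel s).M ⊆ s.M ∪ s.P := by
  refine (B.boostLoop_induction γ τ sel (fun t => t.M ⊆ s.M ∪ s.P ∧ t.P ⊆ s.P) ?_ s
    ⟨Finset.subset_union_left, Finset.Subset.refl _⟩).1.1
  rintro t i hi ⟨hM, hP⟩
  refine ⟨(B.step_M_subset γ τ t i hi).trans (Finset.insert_subset ?_ hM),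
    (Finset.erase_subset _ _).trans hP⟩
  exact Finset.mem_union_right _ (hP (B.nextProposal_mem τ t i hi))

theorem loopInvariant_boostLoop (B : BMPInstance L K) (γ : ℝ) (τ : TieBreaking L K)
    (sel : SelectionRule L K) (D : Finset (L × K)) :
    B.LoopInvariant γ τ D (B.boostLoop γ τ sel ⟨∅, D⟩) :=
  (B.boostLoop_induction γ τ sel (B.LoopInvariant γ τ D) (fun _ i hi h => h.step i hi) _
    (LoopInvariant.initial B γ τ D)).1

theorem boost_subset (B : BMPInstance L K) (γ : ℝ) (τ : TieBreaking L K)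
    (sel : SelectionRule L K) (D : Finset (L × K)) : B.boost γ τ sel D ⊆ D :=
  (B.loopInvariant_boostLoop γ τ sel D).M_subset

theorem isMatching_boost (B : BMPInstance L K) (γ : ℝ) (τ : TieBreaking L K)
    (sel : SelectionRule L K) (D : Finset (L × K)) : IsMatching (B.boost γ τ sel D) :=
  (B.loopInvariant_boostLoop γ τ sel D).matching

/-- The matching computed by Boost is stable. -/
theorem boost_stable (B : BMPInstance L K) (γ : ℝ) (τ : TieBreaking L K)
    (sel : SelectionRule L K) {D : Finset (L × K)} {i : L} {j : K} (hij : (i, j) ∈ D) :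
    (∃ l, (i, l) ∈ B.boost γ τ sel D ∧ B.agentRank τ i j ≤ B.agentRank τ i l) ∨
      ∃ k, (k, j) ∈ B.boost γ τ sel D ∧ B.resourceRank γ τ j i ≤ B.resourceRank γ τ j k := by
  have hinv := B.loopInvariant_boostLoop γ τ sel D
  have hact := (B.boostLoop_induction γ τ sel (fun _ => True) (fun _ _ _ _ => trivial) ⟨∅, D⟩
    trivial).2
  -- If `(i, j)` was never proposed, then `i`, being inactive at the end, holds an edge it proposed
  -- earlier and prefers; otherwise `j` has received the proposal.
  by_cases hP : (i, j) ∈ (B.boostLoop γ τ sel ⟨∅, D⟩).P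
  · left
    by_contra hno
    refine hact ⟨i, Finset.mem_sdiff.2 ⟨Finset.mem_image.2 ⟨_, hP, rfl⟩, fun hM => hno ?_⟩⟩
    obtain ⟨⟨i', l⟩, hl, rfl⟩ := Finset.mem_image.1 hM
    exact ⟨l, hl, (hinv.agentRank_lt i' l j hl hP).le⟩
  · exact Or.inr (hinv.exists_mate i j hij hP)

/-! ### Group-strategyproofness -/

/-- If the agents of a set `A` who prefer a matching `N` to the outcome of Boost are matched by
both in a way that every mate in `N` of an agent of `A` also is a mate of an agent of `A` in the
outcome, then an agent outside `A` forms a blocking pair of `N` with such a mate. -/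
theorem exists_blocking_of_mates_subset [Finite L] (B : BMPInstance L K) (γ : ℝ)
    (τ : TieBreaking L K) (sel : SelectionRule L K) (D N : Finset (L × K)) (hN : IsMatching N)
    (hND : N ⊆ D) (A : Set L) (hA : A.Nonempty)
    (hpref : ∀ i ∈ A, ∃ k, (i, k) ∈ N ∧
      ∀ l, (i, l) ∈ B.boost γ τ sel D → B.agentRank τ i l < B.agentRank τ i k)
    (hmates : ∀ i ∈ A, ∀ j, (i, j) ∈ N → ∃ a ∈ A, (a, j) ∈ B.boost γ τ sel D) :
    ∃ m j a, m ∉ A ∧ (m, j) ∈ D ∧ (a, j) ∈ N ∧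
      B.resourceRank γ τ j a < B.resourceRank γ τ j m ∧
      ∀ l, (m, l) ∈ B.boost γ τ sel D → B.agentRank τ m l < B.agentRank τ m j := by
  have hfin := B.isMatching_boost γ τ sel D
  choose f hfN hfpref using hpref
  choose g hgA hgM using fun (i : A) => hmates i.1 i.2 (f i.1 i.2) (hfN i.1 i.2)
  -- Sending an agent of `A` to the final holder of its mate in `N` is an injective self-map of the
  -- finite set `A`, hence onto: `A` only permutes its resources.
  have hinj : Function.Injective (fun i : A => (⟨g i, hgA i⟩ : A)) := by
    intro a b hab
    have hab' : g a = g b := congrArg Subtype.val hab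
    have h1 := hgM a
    rw [hab'] at h1
    have h2 := hfin.1 _ _ _ h1 (hgM b)
    have h3 := hfN a.1 a.2
    rw [h2] at h3
    exact Subtype.ext (hN.2 _ _ _ h3 (hfN b.1 b.2))
  have hsurj := Finite.surjective_of_injective hinj
  have hboth : ∀ a ∈ A, ∃ j, (a, j) ∈ B.boost γ τ sel D ∧ ∃ b ∈ A, (b, j) ∈ N := by
    intro a ha
    obtain ⟨b, hb⟩ := hsurj ⟨a, ha⟩
    have hb' : g b = a := congrArg Subtype.val hb
    exact ⟨f b.1 b.2, hb' ▸ hgM b, b.1, b.2, hfN b.1 b.2⟩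
  -- Stop just before the step after which, for the first time, all of `A` hold their final edges.
  obtain ⟨t, i, hi, hinv, hT, hT', hloop⟩ := B.exists_step_of_boostLoop γ τ sel
    (B.LoopInvariant γ τ D) (fun s => ∀ a ∈ A, ∃ j, (a, j) ∈ s.M ∧ (a, j) ∈ B.boost γ τ sel D)
    (fun _ i hi h => h.step i hi) ⟨∅, D⟩ (LoopInvariant.initial B γ τ D)
    (by
      intro h
      obtain ⟨a, ha⟩ := hA
      obtain ⟨j, hj, -⟩ := h a ha
      exact Finset.notMem_empty _ hj)
    (by
      intro a ha
      obtain ⟨j, hj, -⟩ := hboth a ha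
      exact ⟨j, hj, hj⟩)
  have hsub : B.boost γ τ sel D ⊆ t.M ∪ t.P := by
    have h1 : B.boost γ τ sel D ⊆ (B.step γ τ t i hi).M ∪ (B.step γ τ t i hi).P := by
      unfold boost
      rw [hloop]
      exact B.boostLoop_M_subset γ τ sel (B.step γ τ t i hi)
    refine h1.trans (Finset.union_subset ((B.step_M_subset γ τ t i hi).trans ?_) ?_)
    · exact Finset.insert_subset
        (Finset.mem_union_right _ (B.nextProposal_mem τ t i hi)) Finset.subset_union_left
    · exact (Finset.erase_subset _ _).trans Finset.subset_union_right
  set j := B.nextProposal τ t i hi with hjdef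
  -- the agent that proposes in this step is the last agent of `A` to find its final mate
  have hold : ∀ a ∈ A, ∀ l, (a, l) ∈ B.boost γ τ sel D → (a, l) ≠ (i, j) → (a, l) ∈ t.M := by
    intro a ha l hl hne
    obtain ⟨l', hl', hl''⟩ := hT' a ha
    obtain rfl := hfin.1 a l l' hl hl''
    exact Finset.mem_of_mem_insert_of_ne (B.step_M_subset γ τ t i hi hl') hne
  have hiA : i ∈ A ∧ (i, j) ∈ B.boost γ τ sel D := by
    by_contra hcon
    refine hT fun a ha => ?_
    obtain ⟨l, hl, -⟩ := hboth a ha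
    refine ⟨l, hold a ha l hl fun he => hcon ?_, hl⟩
    obtain ⟨rfl, h2⟩ := Prod.mk.inj he
    exact ⟨ha, h2 ▸ hl⟩
  obtain ⟨hiA, hij⟩ := hiA
  -- The agent `a` whose mate in `N` is `j` already holds its final edge, which it likes less than
  -- `j`. So `j` has rejected `a`, and at `t` it holds some `m` it prefers to `a`; this `m` is the
  -- blocking agent.
  obtain ⟨j', hj', a, ha, haN⟩ := hboth i hiA
  obtain rfl := hfin.1 i j j' hij hj'
  have hfa : f a ha = j := hN.1 a _ _ (hfN a ha) haN
  have haj : (a, j) ∉ B.boost γ τ sel D := fun h =>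
    absurd (hfpref a ha j h) (by rw [hfa]; exact lt_irrefl _)
  have hai : a ≠ i := fun h => haj (h ▸ hij)
  obtain ⟨l, hl, -⟩ := hboth a ha
  have hlt : (a, l) ∈ t.M := hold a ha l hl fun h => hai (congrArg Prod.fst h)
  have hprop : (a, j) ∉ t.P := fun h =>
    lt_asymm (hinv.agentRank_lt a l j hlt h) (hfa ▸ hfpref a ha l hl)
  obtain ⟨m, hm, hle⟩ := hinv.exists_mate a j (hND haN) hprop
  have hmi : m ≠ i := fun h => notMem_of_active hi j (h ▸ hm)
  have hma : a ≠ m := by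
    rintro rfl
    exact haj (hinv.matching.1 a l j hlt hm ▸ hl)
  have hmj : (m, j) ∉ B.boost γ τ sel D := fun h => hmi (hfin.2 m i j h hij)
  refine ⟨m, j, a, fun hmA => ?_, hinv.M_subset hm, haN,
    lt_of_le_of_ne hle fun h => hma (B.resourceRank_injective γ τ j h), fun k hk => ?_⟩
  -- Every agent of `A` other than `i` holds its final edge at `t`, whereas `(m, j)` is not final.
  · obtain ⟨k, hk, -⟩ := hboth m hmA
    have hkt := hold m hmA k hk fun h => hmi (congrArg Prod.fst h)
    exact hmj (hinv.matching.1 m k j hkt hm ▸ hk)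
  -- Having lost `j`, agent `m` can only end with an edge not yet proposed at `t`, which it ranks
  -- below `j`.
  · rcases Finset.mem_union.1 (hsub hk) with h | h
    · exact absurd (hinv.matching.1 m k j h hm ▸ hk) hmj
    · exact hinv.agentRank_lt m j k hm h

/-- If the agents outside `S` declare the same edges, then no misreport of the agents in `S` makes
all of them strictly better off. -/
theorem no_joint_gain [Finite L] (B : BMPInstance L K) (γ : ℝ) (τ : TieBreaking L K)
    (sel sel' : SelectionRule L K) (D D' : Finset (L × K)) (S : Finset L) (hS : S.Nonempty)
    (hagree : ∀ i ∉ S, ∀ j, (i, j) ∈ D → (i, j) ∈ D') (hsub : B.boost γ τ sel' D' ⊆ D)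
    (hgain : ∀ i ∈ S, ∃ k, (i, k) ∈ B.boost γ τ sel' D' ∧
      ∀ l, (i, l) ∈ B.boost γ τ sel D → B.agentRank τ i l < B.agentRank τ i k) : False := by
  have hM := B.isMatching_boost γ τ sel D
  have hN := B.isMatching_boost γ τ sel' D'
  set N := B.boost γ τ sel' D' with hNdef
  let A : Set L := {i | ∃ k, (i, k) ∈ N ∧
    ∀ l, (i, l) ∈ B.boost γ τ sel D → B.agentRank τ i l < B.agentRank τ i k}
  have hSA : ∀ i ∈ S, i ∈ A := hgain
  -- there is no blocking pair of `N` with an agent outside `A`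
  have hnoblock : ∀ m ∉ A, ∀ j a, (m, j) ∈ D → (a, j) ∈ N →
      B.resourceRank γ τ j a < B.resourceRank γ τ j m →
      ¬ (∀ l, (m, l) ∈ N → B.agentRank τ m l < B.agentRank τ m j) := by
    intro m hm j a hmj haj hlt hall
    rcases B.boost_stable γ τ sel' (hagree m (fun h => hm (hSA m h)) j hmj) with
      ⟨l, hl, hle⟩ | ⟨k, hk, hle⟩
    · exact absurd (hall l hl) (not_lt.2 hle)
    · obtain rfl := hN.2 k a j hk haj
      exact absurd hlt (not_lt.2 hle)
  have hweak : ∀ m ∉ A, ∀ k, (m, k) ∈ N →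
      ∃ l, (m, l) ∈ B.boost γ τ sel D ∧ B.agentRank τ m k ≤ B.agentRank τ m l := by
    intro m hm k hk
    by_contra! hcon
    exact hm ⟨k, hk, hcon⟩
  by_cases hmates : ∀ i ∈ A, ∀ j, (i, j) ∈ N → ∃ a ∈ A, (a, j) ∈ B.boost γ τ sel D
  · obtain ⟨s, hs⟩ := hS
    obtain ⟨m, j, a, hmA, hmj, haj, hlt, hall⟩ := B.exists_blocking_of_mates_subset γ τ sel D N hN
      hsub A ⟨s, hSA s hs⟩ (fun i hi => hi) hmates
    refine hnoblock m hmA j a hmj haj hlt fun k hk => ?_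
    obtain ⟨l, hl, hle⟩ := hweak m hmA k hk
    exact hle.trans_lt (hall l hl)
  -- Some `i ∈ A` has a mate `j` in `N` that no agent of `A` holds in the truthful outcome. By
  -- stability, `j` holds there some `m ∉ A` that it prefers to `i`, and `(m, j)` blocks `N`.
  · push Not at hmates
    obtain ⟨i, hiA, j, hij, hno⟩ := hmates
    obtain ⟨j', hj', hpref⟩ := hiA
    obtain rfl := hN.1 i j j' hij hj'
    have hijM : (i, j) ∉ B.boost γ τ sel D := fun h => lt_irrefl _ (hpref j h)
    rcases B.boost_stable γ τ sel (hsub hij) with ⟨l, hl, hle⟩ | ⟨m, hm, hle⟩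
    · exact absurd (hpref l hl) (not_lt.2 hle)
    · have hmA : m ∉ A := fun h => hno m h hm
      have hmi : m ≠ i := fun h => hijM (h ▸ hm)
      refine hnoblock m hmA j i (B.boost_subset γ τ sel D hm) hij
        (lt_of_le_of_ne hle fun h => hmi (B.resourceRank_injective γ τ j h).symm) fun k hk => ?_
      obtain ⟨l, hl, hle'⟩ := hweak m hmA k hk
      obtain rfl := hM.1 m j l hm hl
      refine lt_of_le_of_ne hle' fun h => hmi ?_
      obtain rfl := B.agentRank_injective τ m h
      exact hN.2 m i k hk hij

/-! ### Approximation -/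

/-- Charging a matching `N` against `M`, where an edge of `N` is charged to the edges of `M` at its
agent and at its resource. -/
theorem sum_charge_le (M N : Finset (L × K)) (hN : IsMatching N) (w w' : L × K → ℝ)
    (v : L × K → ℝ) (hw : ∀ e ∈ M, 0 ≤ w e) (hw' : ∀ e ∈ M, 0 ≤ w' e)
    (h : ∀ e ∈ N, v e ≤ (∑ f ∈ M with f.1 = e.1, w f) + ∑ f ∈ M with f.2 = e.2, w' f) :
    ∑ e ∈ N, v e ≤ ∑ f ∈ M, w f + ∑ f ∈ M, w' f := by
  refine (Finset.sum_le_sum h).trans ?_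
  rw [Finset.sum_add_distrib]
  simp only [Finset.sum_filter]
  refine add_le_add ?_ ?_
  · rw [Finset.sum_comm]
    refine Finset.sum_le_sum fun f hf => ?_
    rw [← Finset.sum_filter, Finset.sum_const, nsmul_eq_mul]
    have hc : (N.filter fun e => f.1 = e.1).card ≤ 1 := by
      refine Finset.card_le_one.2 ?_
      rintro ⟨a, b⟩ hab ⟨c, d⟩ hcd
      simp only [Finset.mem_filter] at hab hcd
      obtain ⟨hab, rfl⟩ := hab
      obtain ⟨hcd, rfl⟩ := hcd
      rw [hN.1 _ _ _ hab hcd]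
    exact mul_le_of_le_one_left (hw f hf) (by exact_mod_cast hc)
  · rw [Finset.sum_comm]
    refine Finset.sum_le_sum fun f hf => ?_
    rw [← Finset.sum_filter, Finset.sum_const, nsmul_eq_mul]
    have hc : (N.filter fun e => f.2 = e.2).card ≤ 1 := by
      refine Finset.card_le_one.2 ?_
      rintro ⟨a, b⟩ hab ⟨c, d⟩ hcd
      simp only [Finset.mem_filter] at hab hcd
      obtain ⟨hab, rfl⟩ := hab
      obtain ⟨hcd, rfl⟩ := hcd
      rw [hN.2 _ _ _ hab hcd]
    exact mul_le_of_le_one_left (hw' f hf) (by exact_mod_cast hc)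

theorem le_offer (B : BMPInstance L K) {γ : ℝ} (hγ : 1 ≤ γ) (i : L) (j : K) :
    B.value i j ≤ B.offer γ i j := by
  unfold offer
  split_ifs
  · exact le_mul_of_one_le_left (B.value_pos i j).le hγ
  · exact le_rfl

theorem offer_le (B : BMPInstance L K) {γ : ℝ} (hγ : 1 ≤ γ) (i : L) (j : K) :
    B.offer γ i j ≤ γ * B.value i j := by
  unfold offer
  split_ifs
  · exact le_rfl
  · exact le_mul_of_one_le_left (B.value_pos i j).le hγ

/-- Every matching has at most `1 + γ` times the value of the matching computed by Boost. -/
theorem sum_value_le_boost (B : BMPInstance L K) {γ : ℝ} (hγ : 1 ≤ γ) (τ : TieBreaking L K)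
    (sel : SelectionRule L K) (D N : Finset (L × K)) (hN : IsMatching N) (hND : N ⊆ D) :
    ∑ e ∈ N, B.value e.1 e.2 ≤ (1 + γ) * ∑ e ∈ B.boost γ τ sel D, B.value e.1 e.2 := by
  have hpos : ∀ e : L × K, 0 ≤ B.value e.1 e.2 := fun e => (B.value_pos _ _).le
  have hpos' : ∀ e : L × K, 0 ≤ γ * B.value e.1 e.2 := fun e =>
    mul_nonneg (zero_le_one.trans hγ) (hpos e)
  rw [add_mul, one_mul, Finset.mul_sum]
  refine sum_charge_le _ N hN _ _ _ (fun e _ => hpos e) (fun e _ => hpos' e) ?_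
  rintro ⟨i, j⟩ hij
  rcases B.boost_stable γ τ sel (hND hij) with ⟨l, hl, hle⟩ | ⟨k, hk, hle⟩
  · refine le_add_of_le_of_nonneg ((B.value_le_of_agentRank_le τ hle).trans ?_)
      (Finset.sum_nonneg fun e _ => hpos' e)
    exact le_sum_filter (fun e : L × K => B.value e.1 e.2) hpos hl rfl
  · refine le_add_of_nonneg_of_le (Finset.sum_nonneg fun e _ => hpos e) ?_
    refine ((B.le_offer hγ i j).trans (B.offer_le_of_resourceRank_le γ τ hle)).trans
      ((B.offer_le hγ k j).trans ?_)
    exact le_sum_filter (fun e : L × K => γ * B.value e.1 e.2) hpos' hk rfl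

/-- The declared part of the prediction has at most `(1 + γ) / γ` times the value of the matching
computed by Boost. -/
theorem sum_pred_le_boost (B : BMPInstance L K) {γ : ℝ} (hγ : 1 ≤ γ) (τ : TieBreaking L K)
    (sel : SelectionRule L K) (D : Finset (L × K)) :
    γ * ∑ e ∈ B.pred ∩ D, B.value e.1 e.2 ≤
      (1 + γ) * ∑ e ∈ B.boost γ τ sel D, B.value e.1 e.2 := by
  have hpos : ∀ e : L × K, 0 ≤ B.value e.1 e.2 := fun e => (B.value_pos _ _).le
  have hpos' : ∀ e : L × K, 0 ≤ γ * B.value e.1 e.2 := fun e =>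
    mul_nonneg (zero_le_one.trans hγ) (hpos e)
  have hN : IsMatching (B.pred ∩ D) :=
    ⟨fun i j k h h' => B.pred_matching.1 i j k (Finset.mem_inter.1 h).1 (Finset.mem_inter.1 h').1,
      fun i j k h h' => B.pred_matching.2 i j k (Finset.mem_inter.1 h).1 (Finset.mem_inter.1 h').1⟩
  -- The weights are swapped compared with `sum_value_le_boost`: `γ` at the agent, `1` at the
  -- resource.
  rw [add_comm 1 γ, add_mul, one_mul, Finset.mul_sum, Finset.mul_sum]
  refine sum_charge_le _ _ hN _ _ _ (fun e _ => hpos' e) (fun e _ => hpos e) ?_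
  rintro ⟨i, j⟩ hij
  obtain ⟨hpred, hD⟩ := Finset.mem_inter.1 hij
  have hagent : ∀ l, (i, l) ∈ B.boost γ τ sel D → B.value i j ≤ B.value i l →
      γ * B.value i j ≤ (∑ f ∈ B.boost γ τ sel D with f.1 = i, γ * B.value f.1 f.2) +
        ∑ f ∈ B.boost γ τ sel D with f.2 = j, B.value f.1 f.2 := by
    intro l hl hle
    refine le_add_of_le_of_nonneg
      ((mul_le_mul_of_nonneg_left hle (zero_le_one.trans hγ)).trans ?_)
      (Finset.sum_nonneg fun e _ => hpos e)
    exact le_sum_filter (fun e : L × K => γ * B.value e.1 e.2) hpos' hl rfl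
  rcases B.boost_stable γ τ sel hD with ⟨l, hl, hle⟩ | ⟨k, hk, hle⟩
  · exact hagent l hl (B.value_le_of_agentRank_le τ hle)
  -- A predicted rival can only be `i` itself, since the prediction is a matching; an unpredicted
  -- one makes an unboosted offer.
  · by_cases hkp : (k, j) ∈ B.pred
    · obtain rfl := B.pred_matching.2 k i j hkp hpred
      exact hagent j hk le_rfl
    · have ho := B.offer_le_of_resourceRank_le γ τ hle
      simp only [offer, if_pos hpred, if_neg hkp] at ho
      refine le_add_of_nonneg_of_le (Finset.sum_nonneg fun e _ => hpos' e) (ho.trans ?_)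
      exact le_sum_filter (fun e : L × K => B.value e.1 e.2) hpos hk rfl

end BMPInstance

/-! ### The reduction from Resource Size GAP -/

namespace RSGAPInstance

variable {L R : Type*}

theorem val_nonneg (I : RSGAPInstance L R) (M : Finset (L × R)) : 0 ≤ I.val M :=
  Finset.sum_nonneg fun e _ => (I.value_pos e.1 e.2).le

variable [DecidableEq R]

theorem respectsCapacities_iff (I : RSGAPInstance L R) (M : Finset (L × R)) :
    I.RespectsCapacities M ↔ ∀ j, (M.filter fun e => e.2 = j).card ≤ I.numCopies j := by
  refine forall_congr' fun j => ?_
  have hs : ∑ e ∈ M with e.2 = j, I.size e.2 = (M.filter fun e => e.2 = j).card * I.size j := by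
    rw [← nsmul_eq_mul]
    refine Finset.sum_eq_card_nsmul fun e he => ?_
    rw [(Finset.mem_filter.1 he).2]
  have hnn : 0 ≤ I.capacity j / I.size j :=
    div_nonneg ((I.size_pos j).le.trans (I.size_le_capacity j)) (I.size_pos j).le
  rw [hs, numCopies, Nat.le_floor_iff hnn, le_div_iff₀ (I.size_pos j)]

theorem exists_feasible_optValue (I : RSGAPInstance L R) (D : Finset (L × R)) :
    ∃ M, I.Feasible D M ∧ I.optValue D = I.val M := by
  classical
  unfold optValue
  obtain ⟨M, hM, h⟩ := Finset.exists_mem_eq_sup' (s := D.powerset.filter fun M => I.Feasible D M)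
    ⟨∅, Finset.mem_filter.2 ⟨Finset.empty_mem_powerset D, I.feasible_empty D⟩⟩ I.val
  refine ⟨M, (Finset.mem_filter.1 hM).2, ?_⟩
  convert h

variable [DecidableEq L]

/-- A set of edges that respects the capacities lifts to a set of edges of the copied instance in
which every copy is used at most once. -/
theorem exists_lift (I : RSGAPInstance L R) (M : Finset (L × R)) (hM : I.RespectsCapacities M) :
    ∃ f : L × R → L × I.Copy, (∀ e ∈ M, (f e).1 = e.1 ∧ (f e).2.1 = e.2) ∧
      ∀ e ∈ M, ∀ e' ∈ M, (f e).2 = (f e').2 → e = e' := by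
  rw [respectsCapacities_iff] at hM
  have hnum : ∀ j, ∃ g : {e // e ∈ M.filter fun e => e.2 = j} → Fin (I.numCopies j),
      Function.Injective g := by
    intro j
    refine ⟨fun e => Fin.castLE (hM j) ((M.filter fun e => e.2 = j).equivFin e), ?_⟩
    exact (Fin.castLE_injective (hM j)).comp (Equiv.injective _)
  choose g hg using hnum
  have hcopy : ∀ e : {e // e ∈ M}, e.1 ∈ M.filter fun e' => e'.2 = e.1.2 := fun e =>
    Finset.mem_filter.2 ⟨e.2, rfl⟩
  have hpos : ∀ j, 0 < I.numCopies j := fun j =>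
    Nat.floor_pos.2 ((one_le_div (I.size_pos j)).2 (I.size_le_capacity j))
  -- Outside `M` the copy `0` is a dummy value; it exists because `size j ≤ capacity j`.
  refine ⟨fun e => (e.1, if h : e ∈ M then ⟨e.2, g e.2 ⟨e, hcopy ⟨e, h⟩⟩⟩ else ⟨e.2, 0, hpos _⟩),
    ?_, ?_⟩
  · intro e he
    simp [he]
  · rintro ⟨i, j⟩ he ⟨i', j'⟩ he' h
    simp only [he, he', dif_pos] at h
    obtain rfl : j = j' := congrArg Sigma.fst h
    exact congrArg Subtype.val (hg j (eq_of_heq (Sigma.mk.inj h).2))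

theorem mem_combine_of_mem {S : Finset L} {X Y : Finset (L × R)} {i : L} {j : R} (hi : i ∈ S) :
    (i, j) ∈ combine S X Y ↔ (i, j) ∈ X := by
  simp [combine, hi]

theorem mem_combine_of_notMem {S : Finset L} {X Y : Finset (L × R)} {i : L} {j : R}
    (hi : i ∉ S) : (i, j) ∈ combine S X Y ↔ (i, j) ∈ Y := by
  simp [combine, hi]

variable [Fintype L] [Fintype R]

theorem mem_copyEdges (I : RSGAPInstance L R) (D : Finset (L × R)) (i : L) (c : I.Copy) :
    (i, c) ∈ I.copyEdges D ↔ (i, c.1) ∈ D := by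
  simp [copyEdges]

theorem mem_boost (I : RSGAPInstance L R) (γ : ℝ) (ν : I.PredNumbering)
    (τ : TieBreaking L I.Copy) (sel : Finset (L × R) → SelectionRule L I.Copy)
    (D : Finset (L × R)) (i : L) (j : R) :
    (i, j) ∈ I.boost γ ν τ sel D ↔
      ∃ c : I.Copy, c.1 = j ∧ (i, c) ∈ (I.toBMP ν).boost γ τ (sel D) (I.copyEdges D) := by
  constructor
  · intro h
    obtain ⟨⟨i', c⟩, hc, he⟩ := Finset.mem_image.1 h
    obtain ⟨rfl, rfl⟩ := Prod.mk.inj he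
    exact ⟨c, rfl, hc⟩
  · rintro ⟨c, rfl, hc⟩
    exact Finset.mem_image.2 ⟨(i, c), hc, rfl⟩

theorem boost_subset (I : RSGAPInstance L R) (γ : ℝ) (ν : I.PredNumbering)
    (τ : TieBreaking L I.Copy) (sel : Finset (L × R) → SelectionRule L I.Copy)
    (D : Finset (L × R)) : I.boost γ ν τ sel D ⊆ D := by
  rintro ⟨i, j⟩ h
  obtain ⟨c, rfl, hc⟩ := (I.mem_boost γ ν τ sel D i j).1 h
  exact (I.mem_copyEdges D i c).1 ((I.toBMP ν).boost_subset γ τ (sel D) _ hc)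

theorem isAssignment_boost (I : RSGAPInstance L R) (γ : ℝ) (ν : I.PredNumbering)
    (τ : TieBreaking L I.Copy) (sel : Finset (L × R) → SelectionRule L I.Copy)
    (D : Finset (L × R)) : IsAssignment (I.boost γ ν τ sel D) := by
  intro i j k hj hk
  obtain ⟨c, rfl, hc⟩ := (I.mem_boost γ ν τ sel D i j).1 hj
  obtain ⟨d, rfl, hd⟩ := (I.mem_boost γ ν τ sel D i k).1 hk
  rw [((I.toBMP ν).isMatching_boost γ τ (sel D) _).1 i c d hc hd]

theorem feasible_boost (I : RSGAPInstance L R) (γ : ℝ) (ν : I.PredNumbering)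
    (τ : TieBreaking L I.Copy) (sel : Finset (L × R) → SelectionRule L I.Copy)
    (D : Finset (L × R)) : I.Feasible D (I.boost γ ν τ sel D) := by
  refine ⟨I.boost_subset γ ν τ sel D, I.isAssignment_boost γ ν τ sel D,
    (I.respectsCapacities_iff _).2 fun j => ?_⟩
  have hM := (I.toBMP ν).isMatching_boost γ τ (sel D) (I.copyEdges D)
  have hex : ∀ e ∈ (I.boost γ ν τ sel D).filter fun e => e.2 = j, ∃ l : Fin (I.numCopies j),
      (e.1, (⟨j, l⟩ : I.Copy)) ∈ (I.toBMP ν).boost γ τ (sel D) (I.copyEdges D) := by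
    rintro ⟨i, j'⟩ he
    obtain ⟨he, h2⟩ := Finset.mem_filter.1 he
    obtain ⟨⟨j'', l⟩, rfl, hc⟩ := (I.mem_boost γ ν τ sel D i j').1 he
    obtain rfl : j'' = j := h2
    exact ⟨l, hc⟩
  choose f hf using hex
  rw [← Fintype.card_fin (I.numCopies j), ← Finset.card_univ, ← Finset.card_attach]
  refine Finset.card_le_card_of_injOn (fun e => f e.1 e.2)
    (fun _ _ => Finset.mem_coe.2 (Finset.mem_univ _)) ?_
  rintro ⟨⟨i, j₁⟩, h₁⟩ - ⟨⟨k, j₂⟩, h₂⟩ - he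
  have he' : f (i, j₁) h₁ = f (k, j₂) h₂ := he
  have h3 := hf _ h₁
  rw [he'] at h3
  have h4 := hM.2 _ _ _ h3 (hf _ h₂)
  refine Subtype.ext (Prod.ext h4 ?_)
  exact (Finset.mem_filter.1 h₁).2.trans (Finset.mem_filter.1 h₂).2.symm

/-- Each agent is matched to at most one copy, so no two edges merge when copies are identified. -/
theorem val_boost (I : RSGAPInstance L R) (γ : ℝ) (ν : I.PredNumbering)
    (τ : TieBreaking L I.Copy) (sel : Finset (L × R) → SelectionRule L I.Copy)
    (D : Finset (L × R)) :
    I.val (I.boost γ ν τ sel D) =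
      ∑ e ∈ (I.toBMP ν).boost γ τ (sel D) (I.copyEdges D), (I.toBMP ν).value e.1 e.2 := by
  have hM := (I.toBMP ν).isMatching_boost γ τ (sel D) (I.copyEdges D)
  unfold val boost
  rw [Finset.sum_image]
  · rfl
  · rintro ⟨i, c⟩ hc ⟨k, d⟩ hd he
    obtain ⟨rfl, -⟩ := Prod.mk.inj he
    rw [hM.1 i c d hc hd]

theorem optValue_le_boost (I : RSGAPInstance L R) {γ : ℝ} (hγ : 1 ≤ γ) (ν : I.PredNumbering)
    (τ : TieBreaking L I.Copy) (sel : Finset (L × R) → SelectionRule L I.Copy)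
    (D : Finset (L × R)) : I.optValue D ≤ (1 + γ) * I.val (I.boost γ ν τ sel D) := by
  obtain ⟨M, ⟨hMD, hMa, hMc⟩, hopt⟩ := I.exists_feasible_optValue D
  obtain ⟨f, hf, hinj⟩ := I.exists_lift M hMc
  have hmatch : IsMatching (M.image f) := by
    constructor
    · intro i c d hc hd
      obtain ⟨⟨a, b⟩, he, h1⟩ := Finset.mem_image.1 hc
      obtain ⟨⟨a', b'⟩, he', h2⟩ := Finset.mem_image.1 hd
      have ha := (hf _ he).1
      have ha' := (hf _ he').1
      rw [h1] at ha
      rw [h2] at ha'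
      obtain rfl : i = a := ha
      obtain rfl : i = a' := ha'
      obtain rfl := hMa i b b' he he'
      exact congrArg Prod.snd (h1.symm.trans h2)
    · intro i k c hi hk
      obtain ⟨e, he, h1⟩ := Finset.mem_image.1 hi
      obtain ⟨e', he', h2⟩ := Finset.mem_image.1 hk
      obtain rfl := hinj e he e' he' (by rw [h1, h2])
      exact congrArg Prod.fst (h1.symm.trans h2)
  have hsub : M.image f ⊆ I.copyEdges D := by
    rintro ⟨i, c⟩ hc
    obtain ⟨e, he, h1⟩ := Finset.mem_image.1 hc
    have h2 := hf e he
    rw [h1] at h2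
    rw [mem_copyEdges]
    have h3 : (i, c.1) = e := Prod.ext h2.1 h2.2
    exact h3 ▸ hMD he
  have h := (I.toBMP ν).sum_value_le_boost hγ τ (sel D) _ _ hmatch hsub
  rw [← I.val_boost, Finset.sum_image fun e he e' he' h => hinj e he e' he' (congrArg _ h)] at h
  rw [hopt]
  refine le_of_eq_of_le (Finset.sum_congr rfl fun e he => ?_) h
  change I.value e.1 e.2 = I.value (f e).1 (f e).2.1
  rw [(hf e he).1, (hf e he).2]

theorem val_pred_le_boost (I : RSGAPInstance L R) {γ : ℝ} (hγ : 1 ≤ γ) (ν : I.PredNumbering)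
    (τ : TieBreaking L I.Copy) (sel : Finset (L × R) → SelectionRule L I.Copy)
    (hpred : I.RespectsCapacities I.pred) (D : Finset (L × R)) :
    γ * I.val (I.pred ∩ D) ≤ (1 + γ) * I.val (I.boost γ ν τ sel D) := by
  rw [I.val_boost]
  refine le_trans (mul_le_mul_of_nonneg_left ?_ (zero_le_one.trans hγ))
    ((I.toBMP ν).sum_pred_le_boost hγ τ (sel D) (I.copyEdges D))
  have himg : I.pred ∩ D ⊆
      ((I.toBMP ν).pred ∩ I.copyEdges D).image fun e => (e.1, e.2.1) := by
    rintro ⟨i, j⟩ hij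
    obtain ⟨hp, hD⟩ := Finset.mem_inter.1 hij
    -- The capacity condition on the prediction enters here: no predicted agent is left without a
    -- copy.
    have hlt : ν.idx i j < I.numCopies j :=
      lt_of_lt_of_le ((ν.bijOn j).mapsTo hp) ((I.respectsCapacities_iff _).1 hpred j)
    refine Finset.mem_image.2 ⟨(i, ⟨j, ν.idx i j, hlt⟩), Finset.mem_inter.2 ⟨?_, ?_⟩, rfl⟩
    · exact Finset.mem_filter.2 ⟨Finset.mem_univ _, hp, rfl⟩
    · exact (I.mem_copyEdges _ _ _).2 hD
  unfold val
  refine (Finset.sum_le_sum_of_subset_of_nonneg himg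
    fun e _ _ => (I.value_pos e.1 e.2).le).trans ?_
  exact Finset.sum_image_le_of_nonneg (fun e _ => (I.value_pos _ _).le)

theorem optValue_le_guarantee_mul (I : RSGAPInstance L R) {γ : ℝ} (hγ : 1 ≤ γ)
    (ν : I.PredNumbering) (τ : TieBreaking L I.Copy)
    (sel : Finset (L × R) → SelectionRule L I.Copy) {ηhat : ℝ}
    (hpred : I.RespectsCapacities I.pred) (D : Finset (L × R))
    (herr : I.predictionError D ≤ ηhat) :
    I.optValue D ≤ guarantee ηhat γ * I.val (I.boost γ ν τ sel D) := by
  unfold guarantee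
  split_ifs with hcase
  · have hγ0 : 0 < γ := zero_lt_one.trans_le hγ
    have hη : 0 < 1 - ηhat := by
      have : 0 < 1 / γ := by positivity
      linarith
    have hb := I.val_pred_le_boost hγ ν τ sel hpred D
    have hv := I.val_nonneg (I.boost γ ν τ sel D)
    rw [div_mul_eq_mul_div, le_div_iff₀ (mul_pos hγ0 hη)]
    -- An optimum of `0` occurs only for `D = ∅`, where the quotient in the error is a division by
    -- zero and carries no information.
    rcases le_or_gt (I.optValue D) 0 with h0 | h0
    · exact (mul_nonpos_of_nonpos_of_nonneg h0 (mul_pos hγ0 hη).le).trans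
        (mul_nonneg (by linarith) hv)
    · have h1 : 1 - ηhat ≤ I.val (I.pred ∩ D) / I.optValue D := by
        unfold predictionError at herr
        linarith
      rw [le_div_iff₀ h0] at h1
      calc I.optValue D * (γ * (1 - ηhat)) = γ * ((1 - ηhat) * I.optValue D) := by ring
        _ ≤ γ * I.val (I.pred ∩ D) := mul_le_mul_of_nonneg_left h1 hγ0.le
        _ ≤ _ := hb
  · exact I.optValue_le_boost hγ ν τ sel D

theorem groupStrategyproof_boost (I : RSGAPInstance L R) (γ : ℝ) (ν : I.PredNumbering)
    (τ : TieBreaking L I.Copy) (sel : Finset (L × R) → SelectionRule L I.Copy) :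
    I.GroupStrategyproof (I.boost γ ν τ sel) := by
  intro E D D' S hS
  by_contra! hcon
  have hpos : ∀ e : L × R, 0 ≤ I.value e.1 e.2 := fun e => (I.value_pos _ _).le
  have hN := (I.toBMP ν).isMatching_boost γ τ (sel (combine S D' D))
    (I.copyEdges (combine S D' D))
  -- every member of the group obtains a truthful edge that is worth more than its truthful outcome
  have hgain : ∀ i ∈ S, ∃ c : I.Copy, (i, c) ∈ (I.toBMP ν).boost γ τ (sel (combine S D' D))
      (I.copyEdges (combine S D' D)) ∧ (i, c.1) ∈ E ∧
      I.utility E (I.boost γ ν τ sel (combine S E D)) i < I.value i c.1 := by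
    intro i hi
    have hlt := hcon i hi
    -- Utilities are nonnegative, so a strict gain requires a true edge in the new assignment.
    have hne : ((I.boost γ ν τ sel (combine S D' D) ∩ E).filter fun e => e.1 = i).Nonempty := by
      rw [Finset.nonempty_iff_ne_empty]
      intro h0
      have h1 : I.utility E (I.boost γ ν τ sel (combine S D' D)) i = 0 := by
        unfold utility
        rw [h0, Finset.sum_empty]
      rw [h1] at hlt
      exact absurd hlt (not_lt.2 (Finset.sum_nonneg fun e _ => hpos e))
    obtain ⟨⟨i', j⟩, he⟩ := hne
    rw [Finset.mem_filter] at he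
    obtain ⟨he, hi'⟩ := he
    obtain rfl : i' = i := hi'
    obtain ⟨heM, heE⟩ := Finset.mem_inter.1 he
    have hsingle : ((I.boost γ ν τ sel (combine S D' D) ∩ E).filter fun e => e.1 = i') =
        {(i', j)} := by
      refine Finset.eq_singleton_iff_unique_mem.2
        ⟨Finset.mem_filter.2 ⟨he, rfl⟩, ?_⟩
      rintro ⟨a, b⟩ hab
      rw [Finset.mem_filter] at hab
      obtain ⟨hab, ha⟩ := hab
      obtain rfl : a = i' := ha
      rw [I.isAssignment_boost γ ν τ sel _ a b j (Finset.mem_inter.1 hab).1 heM]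
    have hu : I.utility E (I.boost γ ν τ sel (combine S D' D)) i' = I.value i' j := by
      unfold utility
      rw [hsingle, Finset.sum_singleton]
    obtain ⟨c, rfl, hc⟩ := (I.mem_boost γ ν τ sel _ i' j).1 heM
    exact ⟨c, hc, heE, hu ▸ hlt⟩
  refine (I.toBMP ν).no_joint_gain γ τ (sel (combine S E D)) (sel (combine S D' D))
    (I.copyEdges (combine S E D)) (I.copyEdges (combine S D' D)) S hS ?_ ?_ ?_
  · intro i hi c hc
    rw [mem_copyEdges, mem_combine_of_notMem hi] at hc ⊢
    exact hc
  -- The outcome of the misreport uses only true edges of `S` and unchanged edges of the others, so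
  -- it lies in the truthful declaration.
  · rintro ⟨i, c⟩ hc
    rw [mem_copyEdges]
    by_cases hi : i ∈ S
    · obtain ⟨d, hd, hdE, -⟩ := hgain i hi
      obtain rfl := hN.1 i c d hc hd
      exact (mem_combine_of_mem hi).2 hdE
    · have h := (I.toBMP ν).boost_subset γ τ _ _ hc
      rw [mem_copyEdges, mem_combine_of_notMem hi] at h
      exact (mem_combine_of_notMem hi).2 h
  · intro i hi
    obtain ⟨c, hc, -, hlt⟩ := hgain i hi
    -- A strict gain in value is a strict gain in rank under any tie-breaking, so moving between
    -- copies of one resource never counts as a gain for `S`.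
    refine ⟨c, hc, fun d hd => (I.toBMP ν).agentRank_lt_of_value_lt τ (lt_of_le_of_lt ?_ hlt)⟩
    have hdM : (i, d.1) ∈ I.boost γ ν τ sel (combine S E D) :=
      (I.mem_boost γ ν τ sel _ i d.1).2 ⟨d, rfl, hd⟩
    have hdE : (i, d.1) ∈ E := (mem_combine_of_mem hi).1 (I.boost_subset γ ν τ sel _ hdM)
    exact le_sum_filter (fun e : L × R => I.value e.1 e.2) hpos (Finset.mem_inter.2 ⟨hdM, hdE⟩) rfl

end RSGAPInstance

end GAPPred

theorem corollary4p4 {L R : Type*} [Fintype L] [DecidableEq L] [Fintype R] [DecidableEq R]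
    (I : GAPPred.RSGAPInstance L R) (ν : I.PredNumbering) (τ : GAPPred.TieBreaking L I.Copy)
    (sel : Finset (L × R) → GAPPred.SelectionRule L I.Copy)
    (ηhat : ℝ) (hη₀ : 0 ≤ ηhat) (hη₁ : ηhat ≤ 1) :
    -- every confidence parameter
    (∀ γ : ℝ, 1 ≤ γ →
      (∀ D : Finset (L × R), I.Feasible D (I.boost γ ν τ sel D)) ∧
      I.GroupStrategyproof (I.boost γ ν τ sel) ∧
      (I.RespectsCapacities I.pred → ∀ D : Finset (L × R), I.predictionError D ≤ ηhat →
        I.optValue D ≤ GAPPred.guarantee ηhat γ * I.val (I.boost γ ν τ sel D))) ∧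
    -- no boosting, and no condition on the prediction (which may be empty)
    (I.GroupStrategyproof (I.boost 1 ν τ sel) ∧
      ∀ D : Finset (L × R), I.optValue D ≤ 2 * I.val (I.boost 1 ν τ sel D)) := by
  refine ⟨fun γ hγ => ⟨fun D => I.feasible_boost γ ν τ sel D, I.groupStrategyproof_boost γ ν τ sel,
    fun hpred D herr => I.optValue_le_guarantee_mul hγ ν τ sel hpred D herr⟩,
    I.groupStrategyproof_boost 1 ν τ sel, fun D => ?_⟩
  have h := I.optValue_le_boost le_rfl ν τ sel D
  norm_num at h
  exact h
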